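/- Fix $d \ge 0$ and a feedforward ReLU architecture with layer widths $n_0 = d, n_1, \dots, n_{L-1}, n_L = d$ ($L \ge 1$). For $\theta = (A_l, a_l)_{l=1}^{L} \in \Theta = \prod_{l=1}^{L}(\mathbb{R}^{n_{l-1}\times n_l} \times \mathbb{R}^{n_l})$ let the expert $\mathcal{E}(\cdot;\theta) : \mathbb{R}^d \to \mathbb{R}^d$ be $f_L \circ \sigma \circ f_{L-1} \circ \cdots \circ \sigma \circ f_1$, where $f_l(x) = xA_l + a_l$ and $\sigma$ is the componentwise ReLU $t \mapsto \max(t,0)$. For an integer $n \ge 1$ and $\phi = (W_i, b_i, \theta_i)_{i=1}^{n} \in (\mathbb{R}^d \times \mathbb{R} \times \Theta)^n$, define the Mixture-of-Experts with dense gating by $$\mathcal{D}(x;\phi) = \sum_{i=1}^{n} \frac{e^{W_i x + b_i}}{\sum_{j=1}^{n} e^{W_j x + b_j}}\, \mathcal{E}(x;\theta_i), \qquad x \in \mathbb{R}^d,$$ where $W_i x$ is the standard dot product. **Theorem (Functional equivalence in Mixture-of-Experts with dense gating).** Let $n, n' \ge 1$, and let $\phi = (W_i, b_i, \theta_i)_{i=1}^{n}$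 and $\phi' = (W'_i, b'_i, \theta'_i)_{i=1}^{n'}$ be parameters of two such models over the same architecture that define the same function, $\mathcal{D}(\cdot;\phi) = \mathcal{D}(\cdot;\phi')$ on $\mathbb{R}^d$. Assume that 1. the functions $\mathcal{E}(\cdot;\theta_1), \dots, \mathcal{E}(\cdot;\theta_n)$ are pairwise distinct, and so are the functions $\mathcal{E}(\cdot;\theta'_1), \dots, \mathcal{E}(\cdot;\theta'_{n'})$; 2. the differences $W_i - W_j$, taken over all ordered pairs $(i,j)$ with $i \ne j$ and $1 \le i,j \le n$, are pairwise distinct vectors of $\mathbb{R}^d$ (that is, $W_i - W_j \ne W_k - W_l$ whenever $i \ne j$, $k \ne l$ and $(i,j) \ne (k,l)$), and likewise for the differences $W'_i - W'_j$ with $1 \le i,j \le n'$. Then $n = n'$, and there exist $c_W \in \mathbb{R}^d$, $c_b \in \mathbb{R}$ and a permutation $\tau \in \mathrm{S}_n$ such that for all $i = 1, \dots, n$, $$W'_i = W_{\tau(i)} + c_W, \qquad b'_i = b_{\tau(i)} + c_b, \qquad \mathcal{E}(\cdot;\theta'_i) = \mathcal{E}(\cdot;\theta_{\tau(i)}) \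 \text{ on } \mathbb{R}^d.$$ -/

import Mathlib

namespace MoE

/-- The ReLU activation, applied componentwise. -/
def relu {m : ℕ} (x : Fin m → ℝ) : Fin m → ℝ := fun i => max (x i) 0

/-- Parameters of one affine layer: a weight matrix and a bias vector. -/
structure Layer (m k : ℕ) where
  weight : Matrix (Fin m) (Fin k) ℝ
  bias : Fin k → ℝ

/-- The affine map `x ↦ x W + b` of a layer (row-vector convention). -/
def Layer.apply {m k : ℕ} (f : Layer m k) (x : Fin m → ℝ) : Fin k → ℝ :=
  Matrix.vecMul x f.weight + f.bias

/-- The parameter space of feedforward networks with input width `m`, output width `k`, and the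
list `hidden` of widths of the hidden layers. The number of affine layers is
`hidden.length + 1`, and all weights and biases are free. -/
def NetParams : (m : ℕ) → (hidden : List ℕ) → (k : ℕ) → Type
  | m, [], k => Layer m k
  | m, h :: hs, k => Layer m h × NetParams h hs k

/-- The ReLU network `f_L ∘ σ ∘ f_{L-1} ∘ ⋯ ∘ σ ∘ f_1`: an activation after every affine layer
except the last one. -/
def network : (m : ℕ) → (hidden : List ℕ) → (k : ℕ) → NetParams m hidden k →
    (Fin m → ℝ) → (Fin k → ℝ)
  | _, [], _, f, x => Layer.apply f x
  | _, h :: hs, k, θ, x => network h hs k θ.2 (relu (Layer.apply θ.1 x))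

/-- The expert `𝓔(·; θ) : ℝ^d → ℝ^d` with hidden widths `hidden`. -/
def expert {d : ℕ} {hidden : List ℕ} (θ : NetParams d hidden d) :
    (Fin d → ℝ) → (Fin d → ℝ) :=
  network d hidden d θ

/-- The parameters of one gated expert: gating weight `W`, gating bias `b`, and expert
parameters `θ`. -/
structure GatedExpert (d : ℕ) (hidden : List ℕ) where
  W : Fin d → ℝ
  b : ℝ
  θ : NetParams d hidden d

/-- The weight space `Φ(n) = (ℝ^d × ℝ × Θ)^n`. -/
abbrev WeightSpace (d : ℕ) (hidden : List ℕ) (n : ℕ) : Type := Fin n → GatedExpert d hidden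

/-- `softmax_i (z_1, …, z_n)`. -/
noncomputable def softmax {n : ℕ} (z : Fin n → ℝ) (i : Fin n) : ℝ :=
  Real.exp (z i) / ∑ j, Real.exp (z j)

/-- The gating scores `s_i(x) = W_i x + b_i`. -/
def score {d : ℕ} {hidden : List ℕ} {n : ℕ} (φ : WeightSpace d hidden n) (x : Fin d → ℝ) :
    Fin n → ℝ :=
  fun i => dotProduct (φ i).W x + (φ i).b

/-- The Mixture-of-Experts function with dense gating. -/
noncomputable def dense {d : ℕ} {hidden : List ℕ} {n : ℕ} (φ : WeightSpace d hidden n) :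
    (Fin d → ℝ) → (Fin d → ℝ) :=
  fun x => ∑ i, softmax (score φ x) i • expert (φ i).θ x

/-- The functions computed by the experts are pairwise distinct. -/
def DistinctExperts {d : ℕ} {hidden : List ℕ} {n : ℕ} (φ : WeightSpace d hidden n) : Prop :=
  ∀ i j, i ≠ j → expert (φ i).θ ≠ expert (φ j).θ

/-- The differences `W_i - W_j`, over the ordered pairs `(i, j)` with `i ≠ j`, are pairwise
distinct. -/
def DistinctDifferences {d : ℕ} {hidden : List ℕ} {n : ℕ} (φ : WeightSpace d hidden n) : Prop :=
  ∀ i j k l, i ≠ j → k ≠ l → (i, j) ≠ (k, l) →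
    (φ i).W - (φ j).W ≠ (φ k).W - (φ l).W

end MoE

/-! Clearing denominators gives a relation over pairs `(i, j)`: the experts' differences `E_i -
E'_j`, weighted by `exp (s_i + s'_j)`, sum to zero. ReLU networks are affine on a short initial
segment of every ray, and exponentials of distinct linear forms are independent over such functions.
Hence the relation splits by the value of `W_i + W'_j` (`sum_filter_exp_smul_sub`), and a pair whose
sum is attained only once has equal experts.

The lexicographic maxima of the two weight families form such a pair. Translate both maxima to `0`.
A nonzero weight of one family is never uniquely a sum of a weight from each family, since two
experts of one model would then agree; with distinct differences this forces the translated families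
to coincide (`eq_of_sums_not_unique`). Sums of matched weights then collide only trivially: diagonal
pairs identify the experts, and off-diagonal ones the biases. -/

namespace MoE

open Filter Topology

/-! ### Ray-affine maps and ReLU networks -/

/-- A map is ray-affine if it is affine on an initial segment of each ray. -/
def RayAffine {E F : Type*} [AddCommGroup E] [Module ℝ E] [AddCommGroup F] [Module ℝ F]
    (f : E → F) : Prop :=
  ∀ x v, ∃ β, ∀ᶠ t : ℝ in 𝓝[>] 0, f (x + t • v) = f x + t • β

section RayAffine

variable {E F G : Type*} [AddCommGroup E] [Module ℝ E] [AddCommGroup F] [Module ℝ F]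
  [AddCommGroup G] [Module ℝ G]

theorem RayAffine.comp {g : F → G} {f : E → F} (hg : RayAffine g) (hf : RayAffine f) :
    RayAffine (fun x => g (f x)) := by
  intro x v
  obtain ⟨β, hβ⟩ := hf x v
  obtain ⟨γ, hγ⟩ := hg (f x) β
  refine ⟨γ, ?_⟩
  filter_upwards [hβ, hγ] with t h1 h2
  rw [h1, h2]

theorem RayAffine.sub {f g : E → F} (hf : RayAffine f) (hg : RayAffine g) :
    RayAffine (fun x => f x - g x) := by
  intro x v
  obtain ⟨β, hβ⟩ := hf x v
  obtain ⟨γ, hγ⟩ := hg x v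
  refine ⟨β - γ, ?_⟩
  filter_upwards [hβ, hγ] with t h1 h2
  rw [h1, h2, smul_sub]
  abel

theorem RayAffine.const_smul {f : E → F} (a : ℝ) (hf : RayAffine f) :
    RayAffine (fun x => a • f x) := by
  intro x v
  obtain ⟨β, hβ⟩ := hf x v
  refine ⟨a • β, ?_⟩
  filter_upwards [hβ] with t h1
  rw [h1, smul_add, smul_comm]

theorem RayAffine.sum {ι : Type*} (s : Finset ι) {f : ι → E → F} (hf : ∀ i ∈ s, RayAffine (f i)) :
    RayAffine (fun x => ∑ i ∈ s, f i x) := by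
  intro x v
  choose! β hβ using fun i hi => hf i hi x v
  refine ⟨∑ i ∈ s, β i, ?_⟩
  filter_upwards [(Filter.eventually_all_finset s).2 hβ] with t h1
  rw [Finset.smul_sum, ← Finset.sum_add_distrib]
  exact Finset.sum_congr rfl h1

theorem RayAffine.pi {ι : Type*} [Finite ι] {f : E → ι → ℝ} (hf : ∀ i, RayAffine (fun x => f x i)) :
    RayAffine f := by
  intro x v
  choose β hβ using fun i => hf i x v
  refine ⟨β, ?_⟩
  filter_upwards [Filter.eventually_all.2 hβ] with t h1
  funext i
  exact h1 i

theorem RayAffine.apply {ι : Type*} {f : E → ι → ℝ} (hf : RayAffine f) (i : ι) :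
    RayAffine (fun x => f x i) := by
  intro x v
  obtain ⟨β, hβ⟩ := hf x v
  refine ⟨β i, ?_⟩
  filter_upwards [hβ] with t h1
  rw [h1]; rfl

end RayAffine

/-- The kink at `0` is why only one-sided segments are considered: there the slope in direction `v`
is `max v 0`, which is not linear in `v`. -/
theorem rayAffine_max_zero : RayAffine (fun x : ℝ => max x 0) := by
  intro x v
  have hc : ContinuousAt (fun t : ℝ => x + t • v) 0 := by fun_prop
  rcases lt_trichotomy x 0 with hx | rfl | hx
  · refine ⟨0, ?_⟩
    have : ∀ᶠ t : ℝ in 𝓝 0, x + t • v < 0 := hc.eventually_lt continuousAt_const (by simpa using hx)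
    filter_upwards [nhdsWithin_le_nhds this] with t ht
    simp only [max_eq_right ht.le, max_eq_right hx.le, smul_zero, add_zero]
  · refine ⟨max v 0, ?_⟩
    filter_upwards [self_mem_nhdsWithin] with t ht
    have ht : (0 : ℝ) ≤ t := le_of_lt ht
    simp [mul_max_of_nonneg _ _ ht]
  · refine ⟨v, ?_⟩
    have : ∀ᶠ t : ℝ in 𝓝 0, 0 < x + t • v := continuousAt_const.eventually_lt hc (by simpa using hx)
    filter_upwards [nhdsWithin_le_nhds this] with t ht
    simp only [max_eq_left ht.le, max_eq_left hx.le]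

theorem rayAffine_layer {m k : ℕ} (f : Layer m k) : RayAffine f.apply := by
  intro x v
  refine ⟨Matrix.vecMul v f.weight, Eventually.of_forall fun t => ?_⟩
  simp only [Layer.apply, Matrix.add_vecMul, Matrix.smul_vecMul]
  abel

theorem rayAffine_relu {m : ℕ} : RayAffine (relu (m := m)) := by
  refine RayAffine.pi fun i => ?_
  refine rayAffine_max_zero.comp (f := fun x : Fin m → ℝ => x i) fun x v => ⟨v i, ?_⟩
  exact Eventually.of_forall fun t => rfl

theorem rayAffine_network (m : ℕ) (hidden : List ℕ) (k : ℕ) (θ : NetParams m hidden k) :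
    RayAffine (network m hidden k θ) := by
  induction hidden generalizing m with
  | nil => exact rayAffine_layer θ
  | cons h hs ih =>
    exact (ih h θ.2).comp (rayAffine_relu.comp (rayAffine_layer θ.1))

/-! ### Independence of exponentials -/

/-- An exponential polynomial with affine coefficients that vanishes identically has vanishing
coefficients. -/
theorem exp_affine_eq_zero {ι : Type*} (s : Finset ι) (r α β : ι → ℝ)
    (hr : Set.InjOn r s) (h : ∀ t : ℝ, ∑ k ∈ s, Real.exp (r k * t) * (α k + β k * t) = 0) :
    ∀ k ∈ s, α k = 0 ∧ β k = 0 := by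
  classical
  induction s using Finset.induction_on_max_value r with
  | empty => simp
  | insert a s has hmax ih =>
    -- Dividing by the exponential of largest rate `r a` leaves only decaying terms on the right.
    have key : ∀ t : ℝ, α a + β a * t =
        - ∑ k ∈ s, (α k * Real.exp (-(r a - r k) * t) +
          β k * (t * Real.exp (-(r a - r k) * t))) := by
      intro t
      have h1 := h t
      rw [Finset.sum_insert has] at h1
      have h2 : Real.exp (-(r a * t)) * Real.exp (r a * t) = 1 := by
        rw [← Real.exp_add]; simp
      have h3 : ∑ k ∈ s, (α k * Real.exp (-(r a - r k) * t) +
          β k * (t * Real.exp (-(r a - r k) * t))) =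
          Real.exp (-(r a * t)) * ∑ k ∈ s, Real.exp (r k * t) * (α k + β k * t) := by
        rw [Finset.mul_sum]
        refine Finset.sum_congr rfl fun k _ => ?_
        rw [show -(r a - r k) * t = -(r a * t) + r k * t by ring, Real.exp_add]
        ring
      rw [h3]
      linear_combination Real.exp (-(r a * t)) * h1 - (α a + β a * t) * h2
    have hlim : Tendsto (fun t : ℝ => α a + β a * t) atTop (𝓝 0) := by
      have : Tendsto (fun t : ℝ => - ∑ k ∈ s, (α k * Real.exp (-(r a - r k) * t) +
          β k * (t * Real.exp (-(r a - r k) * t)))) atTop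
          (𝓝 (-∑ k ∈ s, (α k * 0 + β k * 0))) := by
        refine (tendsto_finsetSum s fun k hk => ?_).neg
        have hlt : 0 < r a - r k := by
          refine sub_pos.2 (lt_of_le_of_ne (hmax k hk) fun e => has ?_)
          rwa [← hr (by simp [hk]) (by simp) e]
        have e0 := tendsto_rpow_mul_exp_neg_mul_atTop_nhds_zero 0 _ hlt
        have e1 := tendsto_rpow_mul_exp_neg_mul_atTop_nhds_zero 1 _ hlt
        simp only [Real.rpow_zero, Real.rpow_one, one_mul] at e0 e1
        exact (e0.const_mul _).add (e1.const_mul _)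
      simp only [← key] at this
      simpa using this
    have hβ : β a = 0 := by
      have h1 : Tendsto (fun t : ℝ => (α a + β a * (t + 1)) - (α a + β a * t)) atTop
          (𝓝 (0 - 0)) :=
        (hlim.comp (tendsto_atTop_add_const_right _ 1 tendsto_id)).sub hlim
      have h2 : (fun t : ℝ => (α a + β a * (t + 1)) - (α a + β a * t)) = fun _ => β a := by
        funext t; ring
      rw [h2, sub_zero] at h1
      exact tendsto_nhds_unique tendsto_const_nhds h1
    have hα : α a = 0 := by
      simp only [hβ, zero_mul, add_zero] at hlim
      exact tendsto_nhds_unique tendsto_const_nhds hlim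
    intro k hk
    rcases Finset.mem_insert.1 hk with rfl | hk
    · exact ⟨hα, hβ⟩
    · refine ih (hr.mono (by simp)) (fun t => ?_) k hk
      have := h t
      rwa [Finset.sum_insert has, hα, hβ, zero_mul, add_zero, mul_zero, zero_add] at this

/-- There is a direction that separates the points of a finite set of vectors. -/
theorem exists_injOn_dotProduct {d : ℕ} (C : Finset (Fin d → ℝ)) :
    ∃ v : Fin d → ℝ, Set.InjOn (fun c => dotProduct c v) C := by
  obtain ⟨v, hv⟩ := Module.Dual.exists_forall_ne_zero_of_forall_exists
    (K := ℝ) (M := Fin d → ℝ) (ι := {p : C × C // p.1 ≠ p.2})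
    (fun p => dotProductBilin ℝ ℝ (p.1.1.1 - p.1.2.1)) (by
      intro p
      refine ⟨p.1.1.1 - p.1.2.1, fun h => p.2 ?_⟩
      exact Subtype.ext (sub_eq_zero.1 (dotProduct_self_eq_zero.1 h)))
  refine ⟨v, fun a ha b hb hab => ?_⟩
  by_contra hne
  refine hv ⟨(⟨a, ha⟩, ⟨b, hb⟩), fun e => hne (congrArg Subtype.val e)⟩ ?_
  change dotProduct (a - b) v = 0
  rw [sub_dotProduct]
  exact sub_eq_zero.2 hab

/-- Exponentials of distinct linear forms are linearly independent over ray-affine functions. -/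
theorem exp_dotProduct_rayAffine_eq_zero {d : ℕ} (C : Finset (Fin d → ℝ))
    (g : (Fin d → ℝ) → (Fin d → ℝ) → ℝ) (hg : ∀ c ∈ C, RayAffine (g c))
    (h : ∀ x, ∑ c ∈ C, Real.exp (dotProduct c x) * g c x = 0) :
    ∀ c ∈ C, ∀ x, g c x = 0 := by
  obtain ⟨v, hv⟩ := exists_injOn_dotProduct C
  intro c hc x
  choose! β hβ using fun c hc => hg c hc x v
  have hev : ∀ᶠ t : ℝ in 𝓝[>] 0, ∑ c ∈ C, Real.exp (dotProduct c v * t) *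
      (Real.exp (dotProduct c x) * g c x + Real.exp (dotProduct c x) * β c * t) = 0 := by
    filter_upwards [(Filter.eventually_all_finset C).2 hβ] with t ht
    rw [← h (x + t • v)]
    refine Finset.sum_congr rfl fun c hc => ?_
    rw [ht c hc, dotProduct_add, dotProduct_smul, Real.exp_add, smul_eq_mul, smul_eq_mul,
      mul_comm t (dotProduct c v)]
    ring
  -- With the local slopes `β` frozen, the sum is analytic in `t`, so its vanishing for small `t >
  -- 0` extends to the whole line.
  have hall := AnalyticOnNhd.eq_of_frequently_eq (𝕜 := ℝ) (z₀ := 0)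
    (f := fun t : ℝ => ∑ c ∈ C, Real.exp (dotProduct c v * t) *
      (Real.exp (dotProduct c x) * g c x + Real.exp (dotProduct c x) * β c * t))
    (g := fun _ => 0)
    (fun z _ => by fun_prop) (fun z _ => analyticAt_const)
    (hev.frequently.filter_mono (nhdsWithin_mono _ fun t ht => ne_of_gt ht))
  have := (exp_affine_eq_zero C (fun c => dotProduct c v) _ _ hv (congrFun hall) c hc).1
  exact (mul_eq_zero.1 this).resolve_left (Real.exp_ne_zero _)

/-! ### Sums in an ordered group -/

/-- Let `A` and `B` be finite sets with `0 = max A` and `0 ∈ B` that agree above `m ∈ A`. If the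
differences of elements of `A` are pairwise distinct, and no nonzero element of `A` is uniquely a
sum of elements of `A` and `B`, then `m ∈ B`. -/
theorem mem_of_forall_lt_mem_iff {G : Type*} [AddCommGroup G] [LinearOrder G] [IsOrderedAddMonoid G]
    {A B : Finset G} (hA0 : ∀ a ∈ A, a ≤ 0) (h0 : 0 ∈ A) (h0' : 0 ∈ B)
    (hA : ∀ a ∈ A, ∀ b ∈ A, ∀ c ∈ A, ∀ e ∈ A, a ≠ b → c ≠ e → (a, b) ≠ (c, e) → a - b ≠ c - e)
    (hAB : ∀ m ∈ A, m ≠ 0 → ∃ a ∈ A, ∃ b ∈ B, (a, b) ≠ (m, 0) ∧ a + b = m)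
    {m : G} (hm : m ∈ A) (hlt : ∀ x, m < x → (x ∈ A ↔ x ∈ B)) : m ∈ B := by
  by_contra hmB
  have hm0 : m ≠ 0 := by rintro rfl; exact hmB h0'
  obtain ⟨a, ha, b, hb, hne, hsum⟩ := hAB m hm hm0
  have ham : a ≠ m := by
    rintro rfl
    exact hne (by simpa using hsum)
  have hbm : b ≠ m := by rintro rfl; exact hmB hb
  have hb' : b ∈ A := by
    refine (hlt b (lt_of_le_of_ne ?_ hbm.symm)).2 hb
    rw [← hsum]
    exact add_le_of_nonpos_left (hA0 a ha)
  have hb0 : b ≠ 0 := by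
    rintro rfl
    exact ham (by simpa using hsum)
  -- As `b > m` lies in `A`, the identity `m - a = b - 0` is a forbidden coincidence of differences.
  refine hA m hm a ha b hb' 0 h0 ham.symm hb0 (fun e => hbm (Prod.mk.inj e).1.symm) ?_
  rw [← hsum]; abel

/-- Two finite sets with maximum `0` and pairwise distinct differences are equal if none of their
nonzero elements is uniquely a sum of elements of the two sets. -/
theorem eq_of_sums_not_unique {G : Type*} [AddCommGroup G] [LinearOrder G] [IsOrderedAddMonoid G]
    {A B : Finset G} (hA0 : ∀ a ∈ A, a ≤ 0) (hB0 : ∀ b ∈ B, b ≤ 0) (h0 : 0 ∈ A) (h0' : 0 ∈ B)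
    (hA : ∀ a ∈ A, ∀ b ∈ A, ∀ c ∈ A, ∀ e ∈ A, a ≠ b → c ≠ e → (a, b) ≠ (c, e) → a - b ≠ c - e)
    (hB : ∀ a ∈ B, ∀ b ∈ B, ∀ c ∈ B, ∀ e ∈ B, a ≠ b → c ≠ e → (a, b) ≠ (c, e) → a - b ≠ c - e)
    (hAB : ∀ m ∈ A, m ≠ 0 → ∃ a ∈ A, ∃ b ∈ B, (a, b) ≠ (m, 0) ∧ a + b = m)
    (hBA : ∀ m ∈ B, m ≠ 0 → ∃ b ∈ B, ∃ a ∈ A, (b, a) ≠ (m, 0) ∧ b + a = m) : A = B := by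
  by_contra hne
  have hS : (symmDiff A B).Nonempty := Finset.nonempty_iff_ne_empty.2 fun e =>
    hne (symmDiff_eq_bot.1 e)
  set m := (symmDiff A B).max' hS with hmdef
  have hlt : ∀ x, m < x → (x ∈ A ↔ x ∈ B) := by
    intro x hx
    by_contra hx'
    refine absurd ((symmDiff A B).le_max' x ?_) (not_le.2 hx)
    rw [Finset.mem_symmDiff]; tauto
  have hm := (symmDiff A B).max'_mem hS
  rw [Finset.mem_symmDiff] at hm
  rcases hm with ⟨h1, h2⟩ | ⟨h1, h2⟩
  · exact h2 (mem_of_forall_lt_mem_iff hA0 h0 h0' hA hAB h1 hlt)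
  · exact h2 (mem_of_forall_lt_mem_iff hB0 h0' h0 hB hBA h1 fun x hx => (hlt x hx).symm)

/-! ### Relations between equivalent models -/

section Equivalence

variable {d n n' : ℕ} {hidden : List ℕ} {φ : WeightSpace d hidden n} {φ' : WeightSpace d hidden n'}

theorem DistinctDifferences.injective (hW : DistinctDifferences φ) :
    Function.Injective fun i => (φ i).W := by
  intro i j hij
  by_contra hne
  refine hW i j j i hne (Ne.symm hne) (fun e => hne (Prod.mk.inj e).1) ?_
  simp only at hij
  rw [hij]

/-- In a set of gating weights with distinct differences, `W i + W j = W k + W l` is only possible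
for `k = i` or `l = i`. -/
theorem DistinctDifferences.eq_or_eq (hW : DistinctDifferences φ) {i j k l : Fin n}
    (h : (φ i).W + (φ j).W = (φ k).W + (φ l).W) : k = i ∨ l = i := by
  by_contra! hne
  have hlj : l ≠ j := by
    rintro rfl
    exact hne.1 (hW.injective (add_right_cancel h)).symm
  refine hW i k l j hne.1.symm hlj (fun e => hne.2 (Prod.mk.inj e).1.symm) ?_
  rw [sub_eq_sub_iff_add_eq_add, h, add_comm]

theorem sum_exp_smul_dense (hn : 0 < n) (x : Fin d → ℝ) :
    (∑ i, Real.exp (score φ x i)) • dense φ x =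
      ∑ i, Real.exp (score φ x i) • expert (φ i).θ x := by
  have : Nonempty (Fin n) := ⟨⟨0, hn⟩⟩
  have hpos : 0 < ∑ i, Real.exp (score φ x i) :=
    Finset.sum_pos (fun i _ => Real.exp_pos _) Finset.univ_nonempty
  rw [dense, Finset.smul_sum]
  refine Finset.sum_congr rfl fun i _ => ?_
  rw [softmax, smul_smul, mul_div_cancel₀ _ hpos.ne']

theorem sum_sum_exp_smul_sub (hn : 0 < n) (hn' : 0 < n') (hD : dense φ = dense φ')
    (x : Fin d → ℝ) :
    ∑ p : Fin n × Fin n', (Real.exp (score φ x p.1) * Real.exp (score φ' x p.2)) •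
      (expert (φ p.1).θ x - expert (φ' p.2).θ x) = 0 := by
  have h1 := sum_exp_smul_dense (φ := φ) hn x
  have h2 := sum_exp_smul_dense (φ := φ') hn' x
  rw [hD] at h1
  simp only [smul_sub, Finset.sum_sub_distrib]
  rw [Fintype.sum_prod_type_right, Fintype.sum_prod_type, sub_eq_zero]
  trans (∑ j, Real.exp (score φ' x j)) • ∑ i, Real.exp (score φ x i) • expert (φ i).θ x
  · rw [Finset.sum_smul]
    refine Finset.sum_congr rfl fun j _ => ?_
    rw [Finset.smul_sum]
    refine Finset.sum_congr rfl fun i _ => ?_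
    rw [smul_smul, mul_comm]
  · rw [← h1, smul_comm, h2, Finset.sum_smul]
    refine Finset.sum_congr rfl fun j _ => ?_
    rw [Finset.smul_sum]
    refine Finset.sum_congr rfl fun i _ => ?_
    rw [smul_smul]

/-- The relation between the experts of two equivalent models that belongs to a fixed value of the
sum of gating weights. -/
theorem sum_filter_exp_smul_sub (hn : 0 < n) (hn' : 0 < n') (hD : dense φ = dense φ')
    (c x : Fin d → ℝ) :
    ∑ p : Fin n × Fin n' with (φ p.1).W + (φ' p.2).W = c,
      Real.exp ((φ p.1).b + (φ' p.2).b) • (expert (φ p.1).θ x - expert (φ' p.2).θ x) = 0 := by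
  classical
  set u : Fin n × Fin n' → Fin d → ℝ := fun p => (φ p.1).W + (φ' p.2).W with hu
  set g : (Fin d → ℝ) → (Fin d → ℝ) → Fin d → ℝ := fun c x => ∑ p with u p = c,
    Real.exp ((φ p.1).b + (φ' p.2).b) • (expert (φ p.1).θ x - expert (φ' p.2).θ x) with hg
  change g c x = 0
  by_cases hc : c ∈ Finset.univ.image u
  · funext q
    refine exp_dotProduct_rayAffine_eq_zero (Finset.univ.image u) (fun c x => g c x q)
      (fun c _ => RayAffine.apply (RayAffine.sum _ fun p _ => RayAffine.const_smul _
        (RayAffine.sub (rayAffine_network _ _ _ _) (rayAffine_network _ _ _ _))) q)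
      (fun y => ?_) c hc x
    have h := congrFun (sum_sum_exp_smul_sub hn hn' hD y) q
    rw [← Finset.sum_fiberwise_of_maps_to (t := Finset.univ.image u) (g := u)
      (fun p _ => Finset.mem_image_of_mem u (Finset.mem_univ p)), Finset.sum_apply] at h
    rw [Pi.zero_apply] at h
    rw [← h]
    refine Finset.sum_congr rfl fun c _ => ?_
    simp only [hg, Finset.sum_apply, Finset.mul_sum]
    refine Finset.sum_congr rfl fun p hp => ?_
    rw [← (Finset.mem_filter.1 hp).2, ← Real.exp_add, Pi.smul_apply, Pi.smul_apply, smul_eq_mul,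
      smul_eq_mul, ← mul_assoc, ← Real.exp_add]
    congr 2
    simp only [hu, score, add_dotProduct]
    ring
  · rw [hg]
    refine Finset.sum_eq_zero fun p hp => absurd ?_ hc
    exact Finset.mem_image.2 ⟨p, Finset.mem_univ p, (Finset.mem_filter.1 hp).2⟩

/-- Experts whose gating weights have a unique sum agree. -/
theorem expert_eq_of_forall_add_eq (hn : 0 < n) (hn' : 0 < n') (hD : dense φ = dense φ')
    {i : Fin n} {j : Fin n'}
    (h : ∀ k l, (φ k).W + (φ' l).W = (φ i).W + (φ' j).W → k = i ∧ l = j) :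
    expert (φ i).θ = expert (φ' j).θ := by
  funext x
  have h1 := sum_filter_exp_smul_sub hn hn' hD ((φ i).W + (φ' j).W) x
  rw [show (Finset.univ.filter fun p : Fin n × Fin n' =>
    (φ p.1).W + (φ' p.2).W = (φ i).W + (φ' j).W) = {(i, j)} from ?_, Finset.sum_singleton] at h1
  · exact sub_eq_zero.1 ((smul_eq_zero.1 h1).resolve_left (Real.exp_ne_zero _))
  · ext ⟨k, l⟩
    simp only [Finset.mem_filter, Finset.mem_univ, true_and, Finset.mem_singleton, Prod.mk.injEq]
    exact ⟨h k l, by rintro ⟨rfl, rfl⟩; rfl⟩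

/-! ### Matching gating weights -/

/-- The gating weights relative to a reference one, as elements of a linearly ordered group. -/
noncomputable def relWeights (φ : WeightSpace d hidden n) (i₀ : Fin n) :
    Finset (Lex (Fin d → ℝ)) :=
  Finset.univ.image fun i => toLex ((φ i).W - (φ i₀).W)

theorem mem_relWeights {i₀ : Fin n} {m : Lex (Fin d → ℝ)} :
    m ∈ relWeights φ i₀ ↔ ∃ i, toLex ((φ i).W - (φ i₀).W) = m := by
  simp [relWeights]

theorem zero_mem_relWeights (i₀ : Fin n) : 0 ∈ relWeights φ i₀ :=
  mem_relWeights.2 ⟨i₀, by simp⟩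

theorem relWeights_nonpos {i₀ : Fin n} (h : ∀ i, toLex (φ i).W ≤ toLex (φ i₀).W) :
    ∀ a ∈ relWeights φ i₀, a ≤ 0 := by
  intro a ha
  obtain ⟨i, rfl⟩ := mem_relWeights.1 ha
  rw [toLex_sub]
  exact sub_nonpos.2 (h i)

theorem DistinctDifferences.relWeights (hW : DistinctDifferences φ) (i₀ : Fin n) :
    ∀ a ∈ relWeights φ i₀, ∀ b ∈ relWeights φ i₀, ∀ c ∈ relWeights φ i₀, ∀ e ∈ relWeights φ i₀,
      a ≠ b → c ≠ e → (a, b) ≠ (c, e) → a - b ≠ c - e := by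
  intro a ha b hb c hc e he
  obtain ⟨i, rfl⟩ := mem_relWeights.1 ha
  obtain ⟨j, rfl⟩ := mem_relWeights.1 hb
  obtain ⟨k, rfl⟩ := mem_relWeights.1 hc
  obtain ⟨l, rfl⟩ := mem_relWeights.1 he
  intro hab hce hne h
  refine hW i j k l (fun e => hab (by rw [e])) (fun e => hce (by rw [e]))
    (fun e => hne (by rw [(Prod.mk.inj e).1, (Prod.mk.inj e).2])) ?_
  rw [← toLex_sub, ← toLex_sub, toLex_inj] at h
  simpa using h

/-- Were `m + 0` the only representation of `m = W_i - W_{i₀}`, the pair `(i, j₀)` would have a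
unique sum, giving `E_i = E'_{j₀} = E_{i₀}` with `i ≠ i₀`. -/
theorem exists_add_eq_of_mem_relWeights (hn : 0 < n) (hn' : 0 < n') (hD : dense φ = dense φ')
    (hE : DistinctExperts φ) (hW : DistinctDifferences φ) (hW' : DistinctDifferences φ')
    {i₀ : Fin n} {j₀ : Fin n'} (h₀ : expert (φ i₀).θ = expert (φ' j₀).θ) :
    ∀ m ∈ relWeights φ i₀, m ≠ 0 →
      ∃ a ∈ relWeights φ i₀, ∃ b ∈ relWeights φ' j₀, (a, b) ≠ (m, 0) ∧ a + b = m := by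
  intro m hm hm0
  obtain ⟨i, rfl⟩ := mem_relWeights.1 hm
  by_contra! hcon
  have hi : i ≠ i₀ := by rintro rfl; exact hm0 (by simp)
  refine hE i i₀ hi (h₀ ▸ expert_eq_of_forall_add_eq hn hn' hD fun k l hkl => ?_)
  by_contra hne
  refine hcon _ (mem_relWeights.2 ⟨k, rfl⟩) _ (mem_relWeights.2 ⟨l, rfl⟩) (fun e => hne ?_) ?_
  · obtain ⟨e1, e2⟩ := Prod.mk.inj e
    refine ⟨hW.injective (sub_left_injective (toLex_inj.1 e1)), hW'.injective ?_⟩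
    exact sub_eq_zero.1 (toLex_inj.1 (e2.trans toLex_zero.symm))
  · rw [← toLex_add, toLex_inj, eq_sub_iff_add_eq]
    rw [← sub_eq_zero] at hkl ⊢
    rw [← hkl]
    abel

/-- The gating weights of equivalent models agree up to order and translation, where the
translation matches a pair of equal experts. -/
theorem exists_equal_relWeights (hn : 0 < n) (hn' : 0 < n') (hD : dense φ = dense φ')
    (hE : DistinctExperts φ) (hE' : DistinctExperts φ')
    (hW : DistinctDifferences φ) (hW' : DistinctDifferences φ') :
    ∃ i₀ j₀, expert (φ i₀).θ = expert (φ' j₀).θ ∧ relWeights φ i₀ = relWeights φ' j₀ := by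
  have : Nonempty (Fin n) := ⟨⟨0, hn⟩⟩
  have : Nonempty (Fin n') := ⟨⟨0, hn'⟩⟩
  obtain ⟨i₀, hi₀⟩ := Finite.exists_max fun i => toLex (φ i).W
  obtain ⟨j₀, hj₀⟩ := Finite.exists_max fun j => toLex (φ' j).W
  have h₀ : expert (φ i₀).θ = expert (φ' j₀).θ := by
    refine expert_eq_of_forall_add_eq hn hn' hD fun k l hkl => ?_
    -- A sum of two maxima is attained only by the maxima.
    have := (add_eq_add_iff_eq_and_eq (hi₀ k) (hj₀ l)).1 (congrArg toLex hkl)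
    exact ⟨hW.injective (toLex_inj.1 this.1), hW'.injective (toLex_inj.1 this.2)⟩
  exact ⟨i₀, j₀, h₀, eq_of_sums_not_unique (relWeights_nonpos hi₀) (relWeights_nonpos hj₀)
    (zero_mem_relWeights _) (zero_mem_relWeights _) (hW.relWeights _) (hW'.relWeights _)
    (exists_add_eq_of_mem_relWeights hn hn' hD hE hW hW' h₀)
    (exists_add_eq_of_mem_relWeights hn' hn hD.symm hE' hW' hW h₀.symm)⟩

/-- A translation of gating weights can be realized by a bijection of the indices. -/
theorem exists_equiv_of_relWeights_eq (hW : DistinctDifferences φ) (hW' : DistinctDifferences φ')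
    {i₀ : Fin n} {j₀ : Fin n'} (h : relWeights φ i₀ = relWeights φ' j₀) :
    ∃ e : Fin n' ≃ Fin n, ∀ j, (φ' j).W = (φ (e j)).W + ((φ' j₀).W - (φ i₀).W) := by
  have hex : ∀ j, ∃ i, (φ' j).W = (φ i).W + ((φ' j₀).W - (φ i₀).W) := by
    intro j
    obtain ⟨i, hi⟩ := mem_relWeights.1 (h ▸ mem_relWeights.2 ⟨j, rfl⟩ :
      toLex ((φ' j).W - (φ' j₀).W) ∈ relWeights φ i₀)
    refine ⟨i, ?_⟩
    rw [sub_eq_iff_eq_add.1 (toLex_inj.1 hi).symm]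
    abel
  choose f hf using hex
  refine ⟨Equiv.ofBijective f ⟨fun j k hjk => ?_, fun i => ?_⟩, hf⟩
  · refine hW'.injective ?_
    change (φ' j).W = (φ' k).W
    rw [hf j, hf k, hjk]
  · obtain ⟨j, hj⟩ := mem_relWeights.1 (h ▸ mem_relWeights.2 ⟨i, rfl⟩ :
      toLex ((φ i).W - (φ i₀).W) ∈ relWeights φ' j₀)
    refine ⟨j, hW.injective ?_⟩
    have h1 := hf j
    have h2 := toLex_inj.1 hj
    rw [h1] at h2
    have h3 : (φ (f j)).W + ((φ' j₀).W - (φ i₀).W) - (φ' j₀).W = (φ (f j)).W - (φ i₀).W := by abel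
    rw [h3] at h2
    exact sub_left_injective h2

/-! ### Matching experts and biases -/

theorem exists_equiv (hn : 0 < n) (hn' : 0 < n') (hD : dense φ = dense φ')
    (hE : DistinctExperts φ) (hE' : DistinctExperts φ')
    (hW : DistinctDifferences φ) (hW' : DistinctDifferences φ') :
    ∃ (e : Fin n' ≃ Fin n) (cW : Fin d → ℝ) (cb : ℝ), ∀ j,
      (φ' j).W = (φ (e j)).W + cW ∧ (φ' j).b = (φ (e j)).b + cb ∧
        expert (φ' j).θ = expert (φ (e j)).θ := by
  obtain ⟨i₀, j₀, h₀, hrel⟩ := exists_equal_relWeights hn hn' hD hE hE' hW hW'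
  obtain ⟨e, he⟩ := exists_equiv_of_relWeights_eq hW hW' hrel
  -- Coincidences of mixed sums become coincidences within `φ` alone, where `eq_or_eq` applies.
  have hsum : ∀ k l i j, (φ k).W + (φ' l).W = (φ i).W + (φ' j).W ↔
      (φ k).W + (φ (e l)).W = (φ i).W + (φ (e j)).W := by
    intro k l i j
    rw [he l, he j, ← add_assoc, ← add_assoc, add_left_inj]
  have hexp : ∀ j, expert (φ' j).θ = expert (φ (e j)).θ := by
    intro j
    refine (expert_eq_of_forall_add_eq hn hn' hD fun k l hkl => ?_).symm
    rw [hsum] at hkl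
    rcases hW.eq_or_eq hkl.symm with rfl | h
    · exact ⟨rfl, e.injective (hW.injective (add_left_cancel hkl))⟩
    · rw [h] at hkl
      exact ⟨hW.injective (add_right_cancel hkl), e.injective h⟩
  have he₀ : e j₀ = i₀ := by
    by_contra hne
    exact hE _ _ hne ((hexp j₀).symm.trans h₀.symm)
  refine ⟨e, (φ' j₀).W - (φ i₀).W, (φ' j₀).b - (φ i₀).b, fun j => ⟨he j, ?_, hexp j⟩⟩
  by_cases hj : j = j₀
  · rw [hj, he₀]; ring
  have hne : e j ≠ i₀ := fun h => hj (e.injective (h.trans he₀.symm))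
  obtain ⟨x, hx⟩ := Function.ne_iff.1 (hE _ _ hne)
  have h1 := sum_filter_exp_smul_sub hn hn' hD ((φ (e j)).W + (φ' j₀).W) x
  -- Only `(e j, j₀)` and `(i₀, j)` share this sum. Their expert differences are opposite and
  -- nonzero at `x`, so the exponents `b_{e j} + b'_{j₀}` and `b_{i₀} + b'_j` agree.
  rw [show (Finset.univ.filter fun p : Fin n × Fin n' =>
    (φ p.1).W + (φ' p.2).W = (φ (e j)).W + (φ' j₀).W) = {(e j, j₀), (i₀, j)} from ?_,
    Finset.sum_pair (fun h => hne (Prod.mk.inj h).1), hexp, hexp, he₀,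
    ← neg_sub (expert (φ (e j)).θ x) (expert (φ i₀).θ x), smul_neg, ← sub_eq_add_neg,
    ← sub_smul] at h1
  · have h2 := (smul_eq_zero.1 h1).resolve_right (sub_ne_zero.2 hx)
    have h3 := Real.exp_injective (sub_eq_zero.1 h2)
    linarith
  · ext ⟨k, l⟩
    simp only [Finset.mem_filter, Finset.mem_univ, true_and, Finset.mem_insert,
      Finset.mem_singleton, Prod.mk.injEq]
    rw [hsum, he₀]
    constructor
    · intro hkl
      rcases hW.eq_or_eq hkl.symm with rfl | h
      · exact Or.inl ⟨rfl, e.injective ((hW.injective (add_left_cancel hkl)).trans he₀.symm)⟩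
      · rw [h, add_comm] at hkl
        exact Or.inr ⟨hW.injective (add_left_cancel hkl), e.injective h⟩
    · rintro (⟨rfl, rfl⟩ | ⟨rfl, rfl⟩)
      · rw [he₀]
      · exact add_comm _ _

end Equivalence

end MoE

theorem theorem4p1 (d : ℕ) (hidden : List ℕ) (n n' : ℕ) (hn : 0 < n) (hn' : 0 < n')
    (φ : MoE.WeightSpace d hidden n) (φ' : MoE.WeightSpace d hidden n')
    (hD : MoE.dense φ = MoE.dense φ')
    (hE : MoE.DistinctExperts φ) (hE' : MoE.DistinctExperts φ')
    (hW : MoE.DistinctDifferences φ) (hW' : MoE.DistinctDifferences φ') :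
    ∃ h : n = n', ∃ (cW : Fin d → ℝ) (cb : ℝ) (τ : Equiv.Perm (Fin n)),
      ∀ i : Fin n,
        (φ' (Fin.cast h i)).W = (φ (τ i)).W + cW ∧
        (φ' (Fin.cast h i)).b = (φ (τ i)).b + cb ∧
        MoE.expert (φ' (Fin.cast h i)).θ = MoE.expert (φ (τ i)).θ := by
  obtain ⟨e, cW, cb, h⟩ := MoE.exists_equiv hn hn' hD hE hE' hW hW'
  obtain rfl : n' = n := by simpa using Fintype.card_congr e
  exact ⟨rfl, cW, cb, e, h⟩
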